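/- Let $d,s$ be integers with $1\le d\le s$, let $\sigma>0$, and let $A=(a_{ij})$ be a $d\times s$ random matrix with independent $N(0,\sigma^2)$-distributed entries. For a nonempty bounded set $K\subset\mathbb{R}^n$ ($n\ge 1$) put $$M^*(K):=\int_{S^{n-1}}\sup_{y\in K}\langle x,y\rangle\,dx,$$ where the integration is with respect to the normalized Lebesgue (surface) measure on the Euclidean unit sphere $S^{n-1}$. Let $a>0$ and let $S\subset\mathbb{R}^s$ be a symmetric convex body, i.e. a nonempty compact convex set with $S=-S$ (nonempty interior is not required), satisfying $S\subset aB_2^s$, where $B_2^s$ is the closed Euclidean unit ball. Then $M^*(AS)$ is integrable and $$\mathbb{E}\,M^*(AS)=c_s\,\sigma\,M^*(S),\qquad\text{where } c_s=\frac{\sqrt2\,\Gamma\left(\frac{s+1}{2}\right)}{\Gamma\left(\frac s2\right)}\le\sqrt s .$$ Moreover, for every $t>0$, $$\mathbb{P}\bigl(M^*(AS)>c_s\sigma M^*(S)+t\bigr)\le \exp\left(-\frac{d\,t^2}{2a^2\sigma^2}\right).$$ -/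

import Mathlib

open MeasureTheory ProbabilityTheory

noncomputable section

/-- The functional `M^*(S)` of a set `S ⊆ ℝⁿ`: the average of `x ↦ sup_{y ∈ S} ⟨x, y⟩` over the
Euclidean unit sphere of `ℝⁿ`, with respect to the surface measure normalized to total mass one
(`⨍` divides by the total mass). -/
def Mstar {n : ℕ} (S : Set (EuclideanSpace ℝ (Fin n))) : ℝ :=
  ⨍ x : Metric.sphere (0 : EuclideanSpace ℝ (Fin n)) 1,
    (⨆ y : S, inner ℝ (x : EuclideanSpace ℝ (Fin n)) (y : EuclideanSpace ℝ (Fin n)))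
    ∂((volume : Measure (EuclideanSpace ℝ (Fin n))).toSphere)

/-- The image `A S ⊆ ℝᵈ` of a set `S ⊆ ℝˢ` under a real `d × s` matrix `A`. -/
def matImage {d s : ℕ} (A : Matrix (Fin d) (Fin s) ℝ) (S : Set (EuclideanSpace ℝ (Fin s))) :
    Set (EuclideanSpace ℝ (Fin d)) :=
  (fun x : EuclideanSpace ℝ (Fin s) => WithLp.toLp 2 (A.mulVec x.ofLp)) '' S

/-- The constant `c_s = √2 Γ((s+1)/2) / Γ(s/2)`. -/
def gaussConst (s : ℕ) : ℝ :=
  Real.sqrt 2 * Real.Gamma (((s : ℝ) + 1) / 2) / Real.Gamma ((s : ℝ) / 2)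

/-- The entries of the `d × s` random matrix `A`, on the probability space `(Ω, P)`, are
independent and each of them has the law `N(0, σ²)`. -/
structure IsGaussianMatrix {Ω : Type*} [MeasurableSpace Ω] (P : Measure Ω) {d s : ℕ}
    (A : Ω → Matrix (Fin d) (Fin s) ℝ) (σ : ℝ) : Prop where
  indep : iIndepFun (fun (p : Fin d × Fin s) (ω : Ω) => A ω p.1 p.2) P
  law : ∀ i j, HasLaw (fun ω => A ω i j) (gaussianReal 0 (Real.toNNReal (σ ^ 2))) P

end

open scoped ENNReal NNReal Pointwise

/-! Write `h` for the support function of `S`. Since `⟨x, A y⟩ = ⟨Aᵀ x, y⟩`, `M^*(A S)` is the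
spherical mean of `h(Aᵀ x)`.

Mean: for a unit vector `x`, `Aᵀ x` is `σ` times a standard Gaussian vector `g` of `ℝˢ`, so Fubini
gives `σ E h(g)`. As `h` is positively homogeneous, polar coordinates split this into `E‖g‖ = c_s`
times `M^*(S)`.

Deviation: each `G ↦ h(Gᵀ x)` is only `a`-Lipschitz in the Hilbert–Schmidt norm, but the mean of
`‖Gᵀ x‖²` over the sphere is `‖G‖² / d`, so averaging improves the constant to `a / √d`
(`lipschitzWith_MstarImage`). Gaussian concentration with the sharp constant then yields the tail.

That concentration is derived from the one-dimensional Prékopa–Leindler inequality: it gives a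
transport-type inequality for `N(0,1)` which tensorizes (`HasTauProperty`), and testing it on
exponentials of a Lipschitz function bounds the moment generating function. -/

/-! ### Brunn–Minkowski and Prékopa–Leindler on the line. -/

/-- The translates `inf L + K` and `sup K + L` both lie in `K + L` and meet in at most the point
`sup K + inf L`. -/
theorem volume_add_le_volume_add_of_isCompact {K L : Set ℝ} (hK : IsCompact K) (hL : IsCompact L)
    (hK0 : K.Nonempty) (hL0 : L.Nonempty) :
    volume K + volume L ≤ volume (K + L) := by
  set a := sSup K
  set b := sInf L
  have ha : a ∈ K := hK.sSup_mem hK0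
  have hb : b ∈ L := hL.sInf_mem hL0
  have h1 : (fun x => b + x) '' K ∪ (fun x => a + x) '' L ⊆ K + L := by
    rintro _ (⟨x, hx, rfl⟩ | ⟨x, hx, rfl⟩)
    · exact ⟨x, hx, b, hb, add_comm _ _⟩
    · exact ⟨a, ha, x, hx, rfl⟩
  have hd : AEDisjoint volume ((fun x => b + x) '' K) ((fun x => a + x) '' L) := by
    refine measure_mono_null (t := {a + b}) ?_ (by simp)
    rintro _ ⟨⟨x, hx, rfl⟩, ⟨y, hy, hxy⟩⟩
    have h2 : x ≤ a := le_csSup hK.bddAbove hx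
    have h3 : b ≤ y := csInf_le hL.bddBelow hy
    simp only [Set.mem_singleton_iff] at hxy ⊢
    linarith
  have hLm : MeasurableSet ((fun x => a + x) '' L) :=
    (hL.image (by fun_prop)).measurableSet
  calc volume K + volume L
      = volume ((fun x => b + x) '' K) + volume ((fun x => a + x) '' L) := by
        rw [Set.image_add_left, Set.image_add_left, measure_preimage_add, measure_preimage_add]
    _ = _ := (measure_union₀ hLm.nullMeasurableSet hd).symm
    _ ≤ _ := measure_mono h1

/-- The one-dimensional Brunn–Minkowski inequality. -/
theorem volume_add_le_volume_of_add_subset {A B C : Set ℝ} (hA : MeasurableSet A)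
    (hB : MeasurableSet B) (hA0 : A.Nonempty) (hB0 : B.Nonempty) (hC : A + B ⊆ C) :
    volume A + volume B ≤ volume C := by
  obtain ⟨x, hx⟩ := hA0
  obtain ⟨y, hy⟩ := hB0
  rw [hA.measure_eq_iSup_isCompact, hB.measure_eq_iSup_isCompact]
  simp only [iSup_and']
  refine ENNReal.biSup_add_biSup_le' ⟨∅, by simp⟩ ⟨∅, by simp⟩ fun K hK L hL => ?_
  -- The approximating compact sets may be empty; adjoining a point of `A` or `B` repairs this.
  calc volume K + volume L ≤ volume (insert x K) + volume (insert y L) := by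
        gcongr <;> exact Set.subset_insert _ _
    _ ≤ volume (insert x K + insert y L) := volume_add_le_volume_add_of_isCompact
        (hK.2.insert x) (hL.2.insert y) (Set.insert_nonempty _ _) (Set.insert_nonempty _ _)
    _ ≤ volume C := measure_mono ((Set.add_subset_add (Set.insert_subset hx hK.1)
        (Set.insert_subset hy hL.1)).trans hC)

theorem weighted_volume_add_le {A B C : Set ℝ} (hA : MeasurableSet A)
    (hB : MeasurableSet B) (hA0 : A.Nonempty) (hB0 : B.Nonempty) {p q : ℝ} (hp : 0 < p)
    (hq : 0 < q) (hC : ∀ x ∈ A, ∀ y ∈ B, p * x + q * y ∈ C) :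
    ENNReal.ofReal p * volume A + ENNReal.ofReal q * volume B ≤ volume C := by
  have := volume_add_le_volume_of_add_subset (A := p • A) (B := q • B) (C := C)
    (hA.const_smul₀ p) (hB.const_smul₀ q) hA0.smul_set hB0.smul_set (by
      rintro _ ⟨_, ⟨x, hx, rfl⟩, _, ⟨y, hy, rfl⟩, rfl⟩
      exact hC x hx y hy)
  simpa [Measure.addHaar_smul, abs_of_pos hp, abs_of_pos hq] using this

theorem lintegral_eq_lintegral_Ioo_of_le_one {f : ℝ → ℝ≥0∞} (hf : Measurable f)
    (h1 : ∀ x, f x ≤ 1) :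
    ∫⁻ x, f x = ∫⁻ t in Set.Ioo (0 : ℝ) 1, volume {x | ENNReal.ofReal t < f x} := by
  have hfin : ∀ x, f x ≠ ∞ := fun x => ((h1 x).trans_lt ENNReal.one_lt_top).ne
  have e1 : ∫⁻ x, f x = ∫⁻ x, ENNReal.ofReal (f x).toReal := by
    simp [ENNReal.ofReal_toReal, hfin]
  rw [e1, lintegral_eq_lintegral_meas_lt _ (.of_forall fun x => ENNReal.toReal_nonneg)
    hf.ennreal_toReal.aemeasurable]
  have e2 : ∀ t ∈ Set.Ioi (0 : ℝ), volume {x | t < (f x).toReal}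
      = (Set.Ioo (0 : ℝ) 1).indicator (fun t => volume {x | ENNReal.ofReal t < f x}) t := by
    intro t (ht : 0 < t)
    by_cases h : t < 1
    · rw [Set.indicator_of_mem (Set.mem_Ioo.2 ⟨ht, h⟩)]
      congr 1; ext x
      simp [ENNReal.ofReal_lt_iff_lt_toReal ht.le (hfin x)]
    · rw [Set.indicator_of_notMem (fun h' => h h'.2)]
      convert measure_empty (μ := volume)
      ext x
      have : (f x).toReal ≤ 1 := ENNReal.toReal_le_of_le_ofReal zero_le_one (by simpa using h1 x)
      simp only [Set.mem_ofPred_eq, Set.mem_empty_iff_false, iff_false, not_lt]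
      linarith
  rw [setLIntegral_congr_fun measurableSet_Ioi e2, setLIntegral_indicator measurableSet_Ioo]
  congr 2
  ext x; simp +contextual

theorem ENNReal.geom_mean_le_arith_mean_of_pos {p q : ℝ} (hp : 0 < p) (hq : 0 < q) (hpq : p + q = 1)
    (a b : ℝ≥0∞) : a ^ p * b ^ q ≤ ENNReal.ofReal p * a + ENNReal.ofReal q * b := by
  by_cases ha : a = ∞
  · simp [ha, hp]
  by_cases hb : b = ∞
  · simp [hb, hq]
  lift a to ℝ≥0 using ha
  lift b to ℝ≥0 using hb
  have := NNReal.geom_mean_le_arith_mean2_weighted p.toNNReal q.toNNReal a b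
    (by rw [← Real.toNNReal_add hp.le hq.le, hpq, Real.toNNReal_one])
  rw [Real.coe_toNNReal _ hp.le, Real.coe_toNNReal _ hq.le] at this
  rw [← ENNReal.coe_rpow_of_nonneg _ hp.le, ← ENNReal.coe_rpow_of_nonneg _ hq.le]
  rw [ENNReal.ofReal, ENNReal.ofReal]
  exact_mod_cast this

/-- When both suprema are 1, the superlevel sets of `u` and `v` at each level `t < 1` are nonempty,
so Brunn–Minkowski applies level by level; the layer-cake formula integrates it over `t`. -/
theorem lintegral_add_le_of_iSup_eq_one {u v h : ℝ → ℝ≥0∞} (hu : Measurable u) (hv : Measurable v)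
    (hh : Measurable h) {p q : ℝ} (hp : 0 < p) (hq : 0 < q) (hpq : p + q = 1)
    (hu1 : ⨆ x, u x = 1) (hv1 : ⨆ x, v x = 1)
    (H : ∀ x y, u x ^ p * v y ^ q ≤ h (p * x + q * y)) :
    ENNReal.ofReal p * (∫⁻ x, u x) + ENNReal.ofReal q * (∫⁻ x, v x) ≤ ∫⁻ x, h x := by
  have hmono : ∀ f : ℝ → ℝ≥0∞, Measurable fun t : ℝ => volume {x | ENNReal.ofReal t < f x} :=
    fun f => Antitone.measurable fun s t hst => measure_mono fun x hx =>
      (ENNReal.ofReal_le_ofReal hst).trans_lt hx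
  calc ENNReal.ofReal p * (∫⁻ x, u x) + ENNReal.ofReal q * (∫⁻ x, v x)
      = ∫⁻ t in Set.Ioo (0 : ℝ) 1, (ENNReal.ofReal p * volume {x | ENNReal.ofReal t < u x}
          + ENNReal.ofReal q * volume {x | ENNReal.ofReal t < v x}) := by
        rw [lintegral_eq_lintegral_Ioo_of_le_one hu (fun x => hu1 ▸ le_iSup u x),
          lintegral_eq_lintegral_Ioo_of_le_one hv (fun x => hv1 ▸ le_iSup v x),
          lintegral_add_left ((hmono u).const_mul _), lintegral_const_mul _ (hmono u),
          lintegral_const_mul _ (hmono v)]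
    -- Cutting `h` at 1 makes the layer-cake formula on `(0, 1)` available for it.
    _ ≤ ∫⁻ t in Set.Ioo (0 : ℝ) 1, volume {x | ENNReal.ofReal t < min (h x) 1} := by
        refine setLIntegral_mono (hmono _) fun t ht => ?_
        have ht1 : ENNReal.ofReal t < 1 := by simpa using ht.2
        refine weighted_volume_add_le (hu measurableSet_Ioi) (hv measurableSet_Ioi)
          (lt_iSup_iff.1 (ht1.trans_eq hu1.symm)) (lt_iSup_iff.1 (ht1.trans_eq hv1.symm)) hp hq ?_
        intro x (hx : _ < u x) y (hy : _ < v y)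
        refine lt_min ((H x y).trans_lt' ?_) ht1
        calc ENNReal.ofReal t = ENNReal.ofReal t ^ p * ENNReal.ofReal t ^ q := by
              rw [← ENNReal.rpow_add _ _ (by simpa using ht.1) ENNReal.ofReal_ne_top, hpq,
                ENNReal.rpow_one]
          _ < _ := ENNReal.mul_lt_mul (ENNReal.rpow_lt_rpow hx hp) (ENNReal.rpow_lt_rpow hy hq)
    _ = ∫⁻ x, min (h x) 1 :=
        (lintegral_eq_lintegral_Ioo_of_le_one (hh.min measurable_const) fun x =>
          min_le_right _ _).symm
    _ ≤ _ := lintegral_mono fun x => min_le_left _ _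

/-- Rescaling `u` and `v` to supremum 1 reduces to the additive inequality, which is stronger than
the multiplicative one by the weighted AM–GM inequality. -/
theorem prekopa_leindler_of_bounded {u v h : ℝ → ℝ≥0∞} (hu : Measurable u) (hv : Measurable v)
    (hh : Measurable h) {p q : ℝ} (hp : 0 < p) (hq : 0 < q) (hpq : p + q = 1)
    (hu1 : ⨆ x, u x ≠ ∞) (hv1 : ⨆ x, v x ≠ ∞)
    (H : ∀ x y, u x ^ p * v y ^ q ≤ h (p * x + q * y)) :
    (∫⁻ x, u x) ^ p * (∫⁻ x, v x) ^ q ≤ ∫⁻ x, h x := by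
  set a := ⨆ x, u x with ha
  set b := ⨆ x, v x with hb
  by_cases ha0 : a = 0
  · have : ∀ x, u x = 0 := by simpa [ha] using ha0
    simp [this, hp]
  by_cases hb0 : b = 0
  · have : ∀ x, v x = 0 := by simpa [hb] using hb0
    simp [this, hq]
  set c := a ^ p * b ^ q with hc
  have hap0 : a ^ p ≠ 0 := by simp [ha0, hu1]
  have hbq0 : b ^ q ≠ 0 := by simp [hb0, hv1]
  have hap : a ^ p ≠ ∞ := ENNReal.rpow_ne_top_of_nonneg hp.le hu1
  have hbq : b ^ q ≠ ∞ := ENNReal.rpow_ne_top_of_nonneg hq.le hv1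
  have hcinv : c⁻¹ = (a⁻¹) ^ p * (b⁻¹) ^ q := by
    rw [hc, ENNReal.mul_inv (Or.inl hap0) (Or.inl hap), ENNReal.inv_rpow, ENNReal.inv_rpow]
  have key := lintegral_add_le_of_iSup_eq_one (u := fun x => a⁻¹ * u x) (v := fun x => b⁻¹ * v x)
    (h := fun x => c⁻¹ * h x) (hu.const_mul _) (hv.const_mul _) (hh.const_mul _) hp hq hpq
    (by rw [← ENNReal.mul_iSup, ENNReal.inv_mul_cancel ha0 hu1])
    (by rw [← ENNReal.mul_iSup, ENNReal.inv_mul_cancel hb0 hv1]) (fun x y => by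
      rw [ENNReal.mul_rpow_of_nonneg _ _ hp.le, ENNReal.mul_rpow_of_nonneg _ _ hq.le, hcinv,
        mul_mul_mul_comm]
      gcongr
      exact H x y)
  have key2 := (ENNReal.geom_mean_le_arith_mean_of_pos hp hq hpq _ _).trans key
  rw [lintegral_const_mul _ hu, lintegral_const_mul _ hv, lintegral_const_mul _ hh,
    ENNReal.mul_rpow_of_nonneg _ _ hp.le, ENNReal.mul_rpow_of_nonneg _ _ hq.le,
    mul_mul_mul_comm, ← hcinv] at key2
  have hc0 : c ≠ 0 := mul_ne_zero hap0 hbq0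
  have hct : c ≠ ∞ := ENNReal.mul_ne_top hap hbq
  exact (ENNReal.mul_le_mul_iff_right (ENNReal.inv_ne_zero.2 hct) (ENNReal.inv_ne_top.2 hc0)).1 key2

theorem lintegral_min_natCast_tendsto {u : ℝ → ℝ≥0∞} (hu : Measurable u) :
    Filter.Tendsto (fun n : ℕ => ∫⁻ x, min (u x) n) Filter.atTop (nhds (∫⁻ x, u x)) := by
  refine lintegral_tendsto_of_tendsto_of_monotone (fun n => (hu.min measurable_const).aemeasurable)
    (.of_forall fun x m n hmn => by dsimp only; gcongr) (.of_forall fun x => ?_)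
  have : Filter.Tendsto (fun n : ℕ => min (u x) (n : ℝ≥0∞)) Filter.atTop (nhds (min (u x) ∞)) :=
    tendsto_const_nhds.min ENNReal.tendsto_nat_nhds_top
  simpa using this

/-- The one-dimensional Prékopa–Leindler inequality. -/
theorem prekopa_leindler {u v h : ℝ → ℝ≥0∞} (hu : Measurable u) (hv : Measurable v)
    (hh : Measurable h) {p q : ℝ} (hp : 0 < p) (hq : 0 < q) (hpq : p + q = 1)
    (H : ∀ x y, u x ^ p * v y ^ q ≤ h (p * x + q * y)) :
    (∫⁻ x, u x) ^ p * (∫⁻ x, v x) ^ q ≤ ∫⁻ x, h x := by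
  by_cases hu0 : ∫⁻ x, u x = 0
  · simp [hu0, hp]
  by_cases hv0 : ∫⁻ x, v x = 0
  · simp [hv0, hq]
  have hup : (∫⁻ x, u x) ^ p ≠ 0 := by simp [hu0, hp.le]
  have hvq : (∫⁻ x, v x) ^ q ≠ 0 := by simp [hv0, hq.le]
  -- Truncate at height `n` and pass to the limit; the zero integrals were set aside to exclude a
  -- limit of the form `0 * ∞`.
  refine le_of_tendsto' (ENNReal.Tendsto.mul
    ((lintegral_min_natCast_tendsto hu).ennrpow_const p) (Or.inl hup)
    ((lintegral_min_natCast_tendsto hv).ennrpow_const q) (Or.inl hvq)) fun n => ?_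
  refine prekopa_leindler_of_bounded (hu.min measurable_const) (hv.min measurable_const) hh hp hq hpq
    ?_ ?_ fun x y => (H x y).trans' ?_
  · exact ((iSup_le fun x => min_le_right _ _).trans_lt (ENNReal.natCast_lt_top n)).ne
  · exact ((iSup_le fun x => min_le_right _ _).trans_lt (ENNReal.natCast_lt_top n)).ne
  · gcongr <;> exact min_le_left _ _

/-! ### Tensorization and the Gaussian case. -/

/-- A Prékopa–Leindler type inequality for the measure `μ` with the cost function `c`; for
Gaussian measures this is an asymmetric form of Maurey's property (τ). -/
def HasTauProperty {X : Type*} [MeasurableSpace X] (μ : Measure X) (c : X → X → ℝ) (p q : ℝ) :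
    Prop :=
  ∀ u v : X → ℝ≥0∞, Measurable u → Measurable v →
    (∀ x y, u x ^ p * v y ^ q ≤ ENNReal.ofReal (Real.exp (c x y))) →
    (∫⁻ x, u x ∂μ) ^ p * (∫⁻ x, v x ∂μ) ^ q ≤ 1

namespace HasTauProperty

variable {X Y : Type*} [MeasurableSpace X] [MeasurableSpace Y] {μ : Measure X} {ν : Measure Y}
  {c : X → X → ℝ} {c' : Y → Y → ℝ} {p q : ℝ}

/-- The factor `exp k` is absorbed by multiplying `u` by `exp (-k / p)`. In a product, `k` is the
cost of the first coordinates, fixed while the second ones are integrated. -/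
theorem lintegral_le_exp (h : HasTauProperty μ c p q) (hp : 0 < p) {u v : X → ℝ≥0∞}
    (hu : Measurable u) (hv : Measurable v) (k : ℝ)
    (H : ∀ x y, u x ^ p * v y ^ q ≤ ENNReal.ofReal (Real.exp (k + c x y))) :
    (∫⁻ x, u x ∂μ) ^ p * (∫⁻ x, v x ∂μ) ^ q ≤ ENNReal.ofReal (Real.exp k) := by
  have e : ∀ z : ℝ≥0∞, (ENNReal.ofReal (Real.exp (-k / p)) * z) ^ p
      = ENNReal.ofReal (Real.exp (-k)) * z ^ p := fun z => by
    rw [ENNReal.mul_rpow_of_nonneg _ _ hp.le, ENNReal.ofReal_rpow_of_pos (Real.exp_pos _),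
      ← Real.exp_mul, div_mul_cancel₀ _ hp.ne']
  have e2 : ENNReal.ofReal (Real.exp k) * ENNReal.ofReal (Real.exp (-k)) = 1 := by
    rw [← ENNReal.ofReal_mul (Real.exp_pos _).le, ← Real.exp_add]; simp
  have := h (fun x => ENNReal.ofReal (Real.exp (-k / p)) * u x) v (hu.const_mul _) hv
    fun x y => by
      rw [e, mul_assoc]
      calc _ ≤ ENNReal.ofReal (Real.exp (-k)) * ENNReal.ofReal (Real.exp (k + c x y)) := by
            gcongr; exact H x y
        _ = _ := by
            rw [← ENNReal.ofReal_mul (Real.exp_pos _).le, ← Real.exp_add, neg_add_cancel_left]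
  rw [lintegral_const_mul _ hu, e, mul_assoc] at this
  calc _ = ENNReal.ofReal (Real.exp k) * (ENNReal.ofReal (Real.exp (-k)) *
        ((∫⁻ x, u x ∂μ) ^ p * (∫⁻ x, v x ∂μ) ^ q)) := by rw [← mul_assoc, e2, one_mul]
    _ ≤ ENNReal.ofReal (Real.exp k) * 1 := by gcongr
    _ = _ := mul_one _

theorem prod [SFinite μ] [SFinite ν] (h : HasTauProperty μ c p q) (h' : HasTauProperty ν c' p q)
    (hp : 0 < p) :
    HasTauProperty (μ.prod ν) (fun x y => c x.1 y.1 + c' x.2 y.2) p q := by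
  intro u v hu hv H
  rw [lintegral_prod _ hu.aemeasurable, lintegral_prod _ hv.aemeasurable]
  refine h _ _ hu.lintegral_prod_right' hv.lintegral_prod_right' fun x y => ?_
  exact h'.lintegral_le_exp hp (hu.comp measurable_prodMk_left) (hv.comp measurable_prodMk_left)
    _ fun z w => H (x, z) (y, w)

theorem map {f : X → Y} (hf : Measurable f)
    (h : HasTauProperty μ (fun x y => c' (f x) (f y)) p q) :
    HasTauProperty (μ.map f) c' p q := by
  intro u v hu hv H
  rw [lintegral_map hu hf, lintegral_map hv hf]
  exact h _ _ (hu.comp hf) (hv.comp hf) fun x y => H _ _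

theorem pi [SigmaFinite μ] (h : HasTauProperty μ c p q) (hp : 0 < p) (n : ℕ) :
    HasTauProperty (Measure.pi fun _ : Fin n => μ) (fun x y => ∑ i, c (x i) (y i)) p q := by
  induction n with
  | zero =>
    intro u v hu hv H
    rw [Measure.pi_of_empty _ (fun i => i.elim0), lintegral_dirac' _ hu, lintegral_dirac' _ hv]
    simpa using H _ _
  | succ n ih =>
    have e := (measurePreserving_piFinSuccAbove (fun _ : Fin (n + 1) => μ) 0).symm
    rw [← e.map_eq]
    refine HasTauProperty.map (MeasurableEquiv.measurable _) ?_
    convert h.prod ih hp using 3 with x y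
    simp [Fin.sum_univ_succ, MeasurableEquiv.piFinSuccAbove_symm_apply]

end HasTauProperty

/-- Prékopa–Leindler for `φu`, `φv` and `φ`, with `φ` the Gaussian density: the cost is exactly the
defect in `p x² + q y² = (p x + q y)² + p q (x - y)²`. -/
theorem hasTauProperty_gaussianReal {p q : ℝ} (hp : 0 < p) (hq : 0 < q) (hpq : p + q = 1) :
    HasTauProperty (gaussianReal 0 1) (fun x y => p * q * (x - y) ^ 2 / 2) p q := by
  intro u v hu hv H
  have hφ := measurable_gaussianPDF 0 1
  rw [gaussianReal_of_var_ne_zero _ one_ne_zero, lintegral_withDensity_eq_lintegral_mul _ hφ hu,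
    lintegral_withDensity_eq_lintegral_mul _ hφ hv]
  refine (prekopa_leindler (hφ.mul hu) (hφ.mul hv) hφ hp hq hpq fun x y => ?_).trans
    (lintegral_gaussianPDF_eq_one 0 one_ne_zero).le
  simp only [Pi.mul_apply]
  rw [ENNReal.mul_rpow_of_nonneg _ _ hp.le, ENNReal.mul_rpow_of_nonneg _ _ hq.le, mul_mul_mul_comm]
  calc _ ≤ gaussianPDF 0 1 x ^ p * gaussianPDF 0 1 y ^ q *
        ENNReal.ofReal (Real.exp (p * q * (x - y) ^ 2 / 2)) := by gcongr; exact H x y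
    _ = _ := by
      have hc : 0 < (Real.sqrt (2 * Real.pi * (1 : ℝ≥0)))⁻¹ := by positivity
      simp only [gaussianPDF, gaussianPDFReal]
      rw [ENNReal.ofReal_rpow_of_pos (by positivity), ENNReal.ofReal_rpow_of_pos (by positivity),
        ← ENNReal.ofReal_mul (by positivity), ← ENNReal.ofReal_mul (by positivity),
        Real.mul_rpow hc.le (Real.exp_pos _).le, Real.mul_rpow hc.le (Real.exp_pos _).le,
        mul_mul_mul_comm, ← Real.rpow_add hc, hpq, Real.rpow_one, ← Real.exp_mul, ← Real.exp_mul,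
        ← Real.exp_add, mul_assoc, ← Real.exp_add]
      congr 3
      obtain rfl : q = 1 - p := by linarith
      simp only [NNReal.coe_one]
      ring

/-! ### Gaussian concentration for Lipschitz functions. -/

section

variable {E : Type*} [NormedAddCommGroup E] [InnerProductSpace ℝ E] [FiniteDimensional ℝ E]
  [MeasurableSpace E] [BorelSpace E]

theorem hasTauProperty_stdGaussian {p q : ℝ} (hp : 0 < p) (hq : 0 < q) (hpq : p + q = 1) :
    HasTauProperty (stdGaussian E) (fun x y => p * q * ‖x - y‖ ^ 2 / 2) p q := by
  rw [← stdGaussian_map (stdOrthonormalBasis ℝ E).repr.symm, ← map_pi_eq_stdGaussian]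
  refine .map (LinearIsometryEquiv.continuous _).measurable (.map (by fun_prop) ?_)
  have e : (fun x y => ∑ i, p * q * (x i - y i) ^ 2 / 2) =
      fun x y : Fin (Module.finrank ℝ E) → ℝ => p * q * ‖(stdOrthonormalBasis ℝ E).repr.symm
        (WithLp.toLp 2 x) - (stdOrthonormalBasis ℝ E).repr.symm (WithLp.toLp 2 y)‖ ^ 2 / 2 := by
    funext x y
    rw [← map_sub, LinearIsometryEquiv.norm_map, EuclideanSpace.norm_sq_eq, Finset.mul_sum,
      Finset.sum_div]
    simp
  rw [← e]
  exact (hasTauProperty_gaussianReal hp hq hpq).pi hp _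

theorem integrable_stdGaussian_of_lipschitzWith {K : ℝ≥0} {F : E → ℝ} (hF : LipschitzWith K F) :
    Integrable F (stdGaussian E) := by
  have h1 : Integrable (fun x : E => |F 0| + K * ‖x‖) (stdGaussian E) :=
    (integrable_const _).add ((IsGaussian.integrable_id (μ := stdGaussian E)).norm.const_mul _)
  refine h1.mono' hF.continuous.aestronglyMeasurable (.of_forall fun x => ?_)
  have h2 := hF.dist_le_mul x 0
  rw [Real.dist_eq, dist_zero_right] at h2
  rw [Real.norm_eq_abs]
  linarith [abs_sub_abs_le_abs_sub (F x) (F 0)]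

theorem ofReal_exp_integral_le {X : Type*} [MeasurableSpace X] {μ : Measure X}
    [IsProbabilityMeasure μ] {g : X → ℝ} (hg : Integrable g μ) :
    ENNReal.ofReal (Real.exp (∫ x, g x ∂μ)) ≤ ∫⁻ x, ENNReal.ofReal (Real.exp (g x)) ∂μ := by
  by_cases h : Integrable (fun x => Real.exp (g x)) μ
  · rw [← ofReal_integral_eq_lintegral_ofReal h (.of_forall fun x => (Real.exp_pos _).le)]
    exact ENNReal.ofReal_le_ofReal
      (convexOn_exp.map_integral_le Real.continuous_exp.continuousOn isClosed_univ (by simp) hg h)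
  · have : ∫⁻ x, ENNReal.ofReal (Real.exp (g x)) ∂μ = ∞ := by
      by_contra h'
      refine h ⟨Real.continuous_exp.comp_aestronglyMeasurable hg.1, ?_⟩
      rw [hasFiniteIntegral_iff_ofReal (.of_forall fun x => (Real.exp_pos _).le)]
      exact lt_top_iff_ne_top.2 h'
    simp [this]

/-- The test functions are `exp (-(q / p) F)` and `exp F`. Jensen bounds the first integral, raised
to the power `p`, below by `exp (-q E F)`; every exponent then carries a factor `q`, which cancels.
-/
theorem lintegral_exp_le_of_weights {K : ℝ≥0} {F : E → ℝ} (hF : LipschitzWith K F)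
    {p q : ℝ} (hp : 0 < p) (hq : 0 < q) (hpq : p + q = 1) :
    ∫⁻ x, ENNReal.ofReal (Real.exp (F x)) ∂stdGaussian E
      ≤ ENNReal.ofReal (Real.exp (∫ x, F x ∂stdGaussian E + K ^ 2 / (2 * p))) := by
  set m := ∫ x, F x ∂stdGaussian E with hm
  have hFi := integrable_stdGaussian_of_lipschitzWith hF
  have h1 := (hasTauProperty_stdGaussian (E := E) hp hq hpq).lintegral_le_exp hp
    (u := fun x => ENNReal.ofReal (Real.exp (-(q / p) * F x)))
    (v := fun x => ENNReal.ofReal (Real.exp (F x)))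
    (by have := hF.continuous; fun_prop) (by have := hF.continuous; fun_prop)
    (q * (K ^ 2 / (2 * p))) fun x y => by
      rw [ENNReal.ofReal_rpow_of_pos (Real.exp_pos _), ENNReal.ofReal_rpow_of_pos (Real.exp_pos _),
        ← ENNReal.ofReal_mul (by positivity), ← Real.exp_mul, ← Real.exp_mul, ← Real.exp_add]
      refine ENNReal.ofReal_le_ofReal (Real.exp_le_exp.2 ?_)
      have h2 : F y - F x ≤ K * ‖x - y‖ := by
        have := hF.dist_le_mul y x
        rw [Real.dist_eq, dist_comm, dist_eq_norm] at this
        exact (le_abs_self _).trans this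
      -- Completing the square trades the Lipschitz bound for the quadratic cost.
      have h3 : K * ‖x - y‖ ≤ K ^ 2 / (2 * p) + p * ‖x - y‖ ^ 2 / 2 := by
        rw [← sub_nonneg]
        have : (K : ℝ) ^ 2 / (2 * p) + p * ‖x - y‖ ^ 2 / 2 - K * ‖x - y‖
            = (K - p * ‖x - y‖) ^ 2 / (2 * p) := by field_simp; ring
        rw [this]; positivity
      calc -(q / p) * F x * p + F y * q = q * (F y - F x) := by field_simp; ring
        _ ≤ q * (K ^ 2 / (2 * p) + p * ‖x - y‖ ^ 2 / 2) := by gcongr; exact h2.trans h3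
        _ = _ := by ring
  have h4 : ENNReal.ofReal (Real.exp (-(q * m)))
      ≤ (∫⁻ x, ENNReal.ofReal (Real.exp (-(q / p) * F x)) ∂stdGaussian E) ^ p := by
    calc ENNReal.ofReal (Real.exp (-(q * m)))
        = ENNReal.ofReal (Real.exp (∫ x, -(q / p) * F x ∂stdGaussian E)) ^ p := by
          rw [ENNReal.ofReal_rpow_of_pos (Real.exp_pos _), ← Real.exp_mul, integral_const_mul, ← hm]
          congr 2; field_simp
      _ ≤ _ := by gcongr; exact ofReal_exp_integral_le (hFi.const_mul _)
  have h5 : (∫⁻ x, ENNReal.ofReal (Real.exp (F x)) ∂stdGaussian E) ^ q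
      ≤ ENNReal.ofReal (Real.exp (m + K ^ 2 / (2 * p))) ^ q := by
    have h6 := (mul_le_mul_left h4 _).trans h1
    calc _ = ENNReal.ofReal (Real.exp (q * m)) * (ENNReal.ofReal (Real.exp (-(q * m))) *
          (∫⁻ x, ENNReal.ofReal (Real.exp (F x)) ∂stdGaussian E) ^ q) := by
          rw [← mul_assoc, ← ENNReal.ofReal_mul (by positivity), ← Real.exp_add]; simp
      _ ≤ ENNReal.ofReal (Real.exp (q * m)) * ENNReal.ofReal (Real.exp (q * (K ^ 2 / (2 * p)))) := by
          gcongr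
      _ = _ := by
          rw [← ENNReal.ofReal_mul (by positivity), ← Real.exp_add,
            ENNReal.ofReal_rpow_of_pos (Real.exp_pos _), ← Real.exp_mul]
          congr 2; ring
  exact (ENNReal.rpow_le_rpow_iff hq).1 h5

/-- The moment generating function of a Lipschitz function of a standard Gaussian vector is bounded
by that of a one-dimensional Gaussian variable. -/
theorem lintegral_exp_le_of_lipschitzWith {K : ℝ≥0} {F : E → ℝ} (hF : LipschitzWith K F) :
    ∫⁻ x, ENNReal.ofReal (Real.exp (F x)) ∂stdGaussian E
      ≤ ENNReal.ofReal (Real.exp (∫ x, F x ∂stdGaussian E + K ^ 2 / 2)) := by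
  -- Letting `p` tend to 1 from below recovers the sharp constant `K ^ 2 / 2`.
  have hc : ContinuousAt (fun p : ℝ => ENNReal.ofReal
      (Real.exp (∫ x, F x ∂stdGaussian E + K ^ 2 / (2 * p)))) 1 := by
    refine ENNReal.continuous_ofReal.continuousAt.comp (Real.continuous_exp.continuousAt.comp ?_)
    fun_prop (disch := norm_num)
  have := hc.tendsto.mono_left (nhdsWithin_le_nhds (s := Set.Iio 1))
  simp only [mul_one] at this
  refine ge_of_tendsto this ?_
  filter_upwards [Ioo_mem_nhdsLT (zero_lt_one (α := ℝ))] with p hp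
  exact lintegral_exp_le_of_weights hF hp.1 (sub_pos.2 hp.2) (by ring)

/-- Gaussian concentration with the sharp constant. -/
theorem stdGaussian_measure_ge_le_exp {K : ℝ≥0} (hK : 0 < K) {F : E → ℝ} (hF : LipschitzWith K F)
    {t : ℝ} (ht : 0 < t) :
    (stdGaussian E) {x | ∫ y, F y ∂stdGaussian E + t ≤ F x}
      ≤ ENNReal.ofReal (Real.exp (-t ^ 2 / (2 * K ^ 2))) := by
  set m := ∫ y, F y ∂stdGaussian E with hm
  have hK' : (0 : ℝ) < K := hK
  -- The minimizer of the Chernoff exponent `θ² K² / 2 - θ t`.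
  set θ : ℝ≥0 := ⟨t / K ^ 2, by positivity⟩ with hθ
  have hθ' : (θ : ℝ) = t / K ^ 2 := rfl
  have hθ0 : (0 : ℝ) < θ := by rw [hθ']; positivity
  have hθF : LipschitzWith (θ * K) (fun x => (θ : ℝ) * F x) := by
    refine LipschitzWith.of_dist_le_mul fun x y => ?_
    have := hF.dist_le_mul x y
    rw [Real.dist_eq] at this ⊢
    rw [← mul_sub, abs_mul, abs_of_pos hθ0, NNReal.coe_mul, mul_assoc]
    gcongr
  have h1 := lintegral_exp_le_of_lipschitzWith hθF
  rw [integral_const_mul, ← hm] at h1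
  have h2 : (stdGaussian E) {x | m + t ≤ F x} ≤ (stdGaussian E)
      {x | ENNReal.ofReal (Real.exp (θ * (m + t))) ≤ ENNReal.ofReal (Real.exp (θ * F x))} := by
    refine measure_mono fun x (hx : m + t ≤ F x) => ?_
    refine ENNReal.ofReal_le_ofReal (Real.exp_le_exp.2 ?_)
    gcongr
  refine h2.trans ((meas_ge_le_lintegral_div ?_ ?_ ENNReal.ofReal_ne_top).trans ?_)
  · have := hF.continuous; fun_prop
  · simpa using Real.exp_pos _
  · rw [ENNReal.div_le_iff (by simpa using Real.exp_pos _) ENNReal.ofReal_ne_top]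
    refine h1.trans ?_
    rw [← ENNReal.ofReal_mul (by positivity), ← Real.exp_add]
    refine ENNReal.ofReal_le_ofReal (Real.exp_le_exp.2 (le_of_eq ?_))
    rw [NNReal.coe_mul, hθ']
    field_simp
    ring

end

/-! ### Polar integration and moments of the Gaussian norm. -/

section

variable {E : Type*} [NormedAddCommGroup E] [InnerProductSpace ℝ E] [FiniteDimensional ℝ E]
  [MeasurableSpace E] [BorelSpace E]

/-- Both measures have the same characteristic function. -/
theorem stdGaussian_eq_withDensity :
    stdGaussian E = (volume : Measure E).withDensity fun x => ENNReal.ofReal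
      ((2 * Real.pi) ^ (-(Module.finrank ℝ E : ℝ) / 2) * Real.exp (-(1 / 2) * ‖x‖ ^ 2)) := by
  set C : ℝ := (2 * Real.pi) ^ (-(Module.finrank ℝ E : ℝ) / 2) with hC
  have hC0 : 0 < C := by positivity
  have hC2 : (2 * Real.pi) ^ ((Module.finrank ℝ E : ℝ) / 2) * C = 1 := by
    rw [hC, ← Real.rpow_add (by positivity), neg_div, add_neg_cancel, Real.rpow_zero]
  have hint : ∫ x : E, Real.exp (-(1 / 2) * ‖x‖ ^ 2) = (2 * Real.pi) ^ ((Module.finrank ℝ E : ℝ) / 2)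
      := by
    rw [GaussianFourier.integral_rexp_neg_mul_sq_norm (by norm_num)]
    congr 1; ring
  have hi : Integrable fun x : E => Real.exp (-(1 / 2) * ‖x‖ ^ 2) := by
    by_contra h
    rw [integral_undef h] at hint
    have : (0 : ℝ) < (2 * Real.pi) ^ ((Module.finrank ℝ E : ℝ) / 2) := by positivity
    linarith
  have hfin : IsFiniteMeasure ((volume : Measure E).withDensity fun x => ENNReal.ofReal
      (C * Real.exp (-(1 / 2) * ‖x‖ ^ 2))) := by
    refine isFiniteMeasure_withDensity_ofReal (hi.const_mul C).2
  refine Measure.ext_of_charFun (funext fun t => ?_)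
  rw [charFun_stdGaussian, charFun_apply, integral_withDensity_eq_integral_toReal_smul
    (by fun_prop) (by simp)]
  have h1 : ∀ x : E, (ENNReal.ofReal (C * Real.exp (-(1 / 2) * ‖x‖ ^ 2))).toReal •
      Complex.exp (inner ℝ x t * Complex.I) = (C : ℂ) *
      Complex.exp (-(1 / 2 : ℂ) * ‖x‖ ^ 2 + Complex.I * inner ℝ t x) := fun x => by
    rw [ENNReal.toReal_ofReal (by positivity), Complex.real_smul, Complex.exp_add]
    push_cast
    rw [real_inner_comm, mul_comm Complex.I]
    ring
  simp_rw [h1]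
  rw [integral_const_mul, GaussianFourier.integral_cexp_neg_mul_sq_norm_add (by norm_num)]
  have h2 : ((Real.pi : ℂ) / (1 / 2)) ^ ((Module.finrank ℝ E : ℂ) / 2)
      = (((2 * Real.pi) ^ ((Module.finrank ℝ E : ℝ) / 2) : ℝ) : ℂ) := by
    rw [Complex.ofReal_cpow (by positivity)]
    push_cast
    congr 1; ring
  rw [h2, ← mul_assoc, ← Complex.ofReal_mul, mul_comm C, hC2, Complex.I_sq]
  simp only [Complex.ofReal_one, one_mul]
  congr 1; ring

theorem integral_stdGaussian (φ : E → ℝ) :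
    ∫ x, φ x ∂stdGaussian E = ∫ x, φ x *
      ((2 * Real.pi) ^ (-(Module.finrank ℝ E : ℝ) / 2) * Real.exp (-(1 / 2) * ‖x‖ ^ 2)) := by
  rw [stdGaussian_eq_withDensity, integral_withDensity_eq_integral_toReal_smul
    (by fun_prop) (by simp)]
  refine integral_congr_ae (.of_forall fun x => ?_)
  dsimp only
  rw [ENNReal.toReal_ofReal (by positivity), smul_eq_mul, mul_comm]

variable [Nontrivial E]

open Metric in
theorem integral_homogeneous_mul_radial (μ : Measure E) [μ.IsAddHaarMeasure] {φ : E → ℝ} {k : ℕ}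
    (hφ : ∀ (r : ℝ) (x : E), 0 < r → φ (r • x) = r ^ k * φ x) (g : ℝ → ℝ) :
    ∫ x, φ x * g ‖x‖ ∂μ = (∫ x : sphere (0 : E) 1, φ x ∂μ.toSphere) *
      ∫ r : Set.Ioi (0 : ℝ), (r : ℝ) ^ k * g r ∂.volumeIoiPow (Module.finrank ℝ E - 1) := by
  calc ∫ x, φ x * g ‖x‖ ∂μ = ∫ x : ({(0)}ᶜ : Set E), φ x.1 * g ‖x.1‖ ∂(μ.comap (↑)) := by
        rw [integral_subtype_comap (measurableSet_singleton _).compl fun x ↦ φ x * g ‖x‖,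
          restrict_compl_singleton]
    _ = ∫ x, φ x.1 * (((x.2 : ℝ)) ^ k * g x.2)
          ∂μ.toSphere.prod (.volumeIoiPow (Module.finrank ℝ E - 1)) := by
        rw [← μ.measurePreserving_homeomorphUnitSphereProd.integral_comp
          (Homeomorph.measurableEmbedding _)]
        refine integral_congr_ae (.of_forall fun x => ?_)
        have hx : 0 < ‖x.1‖ := norm_pos_iff.2 x.2
        have h1 : φ x.1 = ‖x.1‖ ^ k * φ (‖x.1‖⁻¹ • x.1) := by
          rw [← hφ _ _ hx, smul_smul, mul_inv_cancel₀ hx.ne', one_smul]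
        simp only [homeomorphUnitSphereProd_apply_snd_coe, homeomorphUnitSphereProd_apply_fst_coe]
        rw [h1]; ring
    _ = _ := integral_prod_mul (μ := μ.toSphere)
          (ν := Measure.volumeIoiPow (Module.finrank ℝ E - 1)) (fun x => φ x)
          (fun r => (r : ℝ) ^ k * g r)

open Metric in
/-- The Gaussian integral of a positively homogeneous function is its spherical mean times the
moment of the norm of the same degree. -/
theorem integral_stdGaussian_of_homogeneous {φ : E → ℝ} {k : ℕ}
    (hφ : ∀ (r : ℝ) (x : E), 0 < r → φ (r • x) = r ^ k * φ x) :
    ∫ x, φ x ∂stdGaussian E = (∫ x, ‖x‖ ^ k ∂stdGaussian E) *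
      ⨍ x : sphere (0 : E) 1, φ x ∂(volume : Measure E).toSphere := by
  set g : ℝ → ℝ := fun r =>
    (2 * Real.pi) ^ (-(Module.finrank ℝ E : ℝ) / 2) * Real.exp (-(1 / 2) * r ^ 2)
  -- `φ` and `‖x‖ ^ k` share the same radial factor, so it never has to be evaluated.
  have h1 := integral_homogeneous_mul_radial (volume : Measure E) hφ g
  have h2 := integral_homogeneous_mul_radial (volume : Measure E) (φ := fun x => ‖x‖ ^ k) (k := k)
    (fun r x hr => by rw [norm_smul, mul_pow, Real.norm_of_nonneg hr.le]) g
  rw [integral_stdGaussian, integral_stdGaussian, h1, h2, average_eq]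
  have h3 : (volume : Measure E).toSphere.real Set.univ ≠ 0 := by
    rw [measureReal_ne_zero_iff, Measure.measure_univ_ne_zero]
    exact Measure.toSphere_ne_zero _
  simp only [norm_eq_of_mem_sphere, one_pow, integral_const, smul_eq_mul, mul_one]
  field_simp

theorem integral_norm_pow_stdGaussian (k : ℕ) :
    ∫ x, ‖x‖ ^ k ∂stdGaussian E = 2 ^ ((k : ℝ) / 2) *
      Real.Gamma (((Module.finrank ℝ E : ℝ) + k) / 2) /
        Real.Gamma ((Module.finrank ℝ E : ℝ) / 2) := by
  set n := Module.finrank ℝ E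
  have hn : 0 < n := Module.finrank_pos
  set C : ℝ := (2 * Real.pi) ^ (-(n : ℝ) / 2)
  set V : ℝ := (volume : Measure E).real (Metric.ball 0 1)
  have key : ∀ j : ℕ, ∫ x, ‖x‖ ^ j ∂stdGaussian E = n * V * C *
      ((1 / 2) ^ (-((n : ℝ) + j) / 2) * (1 / 2) * Real.Gamma (((n : ℝ) + j) / 2)) := fun j => by
    rw [integral_stdGaussian, integral_fun_norm_addHaar volume
      (fun r : ℝ => r ^ j * (C * Real.exp (-(1 / 2) * r ^ 2)))]
    have := integral_rpow_mul_exp_neg_mul_rpow (p := 2) (q := (n - 1 : ℕ) + j) (b := 1 / 2)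
      two_pos (by have : (0 : ℝ) ≤ (n - 1 : ℕ) := by positivity
                  have : (0 : ℝ) ≤ j := by positivity
                  linarith) (by norm_num)
    have e : (((n - 1 : ℕ) : ℝ) + j + 1) = n + j := by rw [Nat.cast_pred hn]; ring
    rw [e] at this
    rw [← this]
    simp only [nsmul_eq_mul, smul_eq_mul]
    rw [mul_assoc, mul_assoc, ← integral_const_mul C]
    congr 2
    refine setIntegral_congr_fun measurableSet_Ioi fun r hr => ?_
    rw [← Nat.cast_add, Real.rpow_natCast, Real.rpow_two, pow_add]
    ring
  -- The case `j = 0` is total mass one, which determines `n * V * C` without computing the volume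
  -- of the ball.
  have h0 := key 0
  simp only [pow_zero, integral_const, probReal_univ, smul_eq_mul, mul_one, CharP.cast_eq_zero,
    add_zero] at h0
  have hG : 0 < Real.Gamma ((n : ℝ) / 2) := Real.Gamma_pos_of_pos (by positivity)
  have e2 : ((1 : ℝ) / 2) ^ (-((n : ℝ) + k) / 2) = (1 / 2) ^ (-(n : ℝ) / 2) * 2 ^ ((k : ℝ) / 2) := by
    rw [show -((n : ℝ) + k) / 2 = -(n : ℝ) / 2 + -((k : ℝ) / 2) by ring,
      Real.rpow_add (by norm_num), one_div, Real.inv_rpow two_pos.le (-((k : ℝ) / 2)),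
      Real.rpow_neg two_pos.le, inv_inv]
  rw [key k, e2, eq_div_iff hG.ne']
  linear_combination (-(2 ^ ((k : ℝ) / 2) * Real.Gamma (((n : ℝ) + k) / 2))) * h0

end

theorem integral_sq_strongDual_stdGaussian {E : Type*} [NormedAddCommGroup E]
    [InnerProductSpace ℝ E] [FiniteDimensional ℝ E] [MeasurableSpace E] [BorelSpace E]
    (L : StrongDual ℝ E) : ∫ x, L x ^ 2 ∂stdGaussian E = ‖L‖ ^ 2 := by
  rw [← variance_dual_stdGaussian, variance_of_integral_eq_zero (by fun_prop)
    (integral_strongDual_stdGaussian L)]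

theorem integral_norm_stdGaussian_euclideanSpace {s : ℕ} (hs : 1 ≤ s) :
    ∫ x, ‖x‖ ∂stdGaussian (EuclideanSpace ℝ (Fin s)) = gaussConst s := by
  have : NeZero s := ⟨by omega⟩
  have := integral_norm_pow_stdGaussian (E := EuclideanSpace ℝ (Fin s)) 1
  simp only [pow_one, Nat.cast_one, finrank_euclideanSpace_fin, ← Real.sqrt_eq_rpow] at this
  exact this

theorem integral_norm_sq_stdGaussian_euclideanSpace {n : ℕ} (hn : 1 ≤ n) :
    ∫ x, ‖x‖ ^ 2 ∂stdGaussian (EuclideanSpace ℝ (Fin n)) = n := by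
  have : NeZero n := ⟨by omega⟩
  have hn' : (0 : ℝ) < (n : ℝ) / 2 := by positivity
  rw [integral_norm_pow_stdGaussian, finrank_euclideanSpace_fin, Nat.cast_ofNat, add_div,
    div_self two_ne_zero, Real.Gamma_add_one hn'.ne', Real.rpow_one]
  have := (Real.Gamma_pos_of_pos hn').ne'
  field_simp

/-- Log-convexity of `Γ` at the midpoint of `s / 2` and `s / 2 + 1`, with `Γ(s/2 + 1) = (s/2)
Γ(s/2)`. -/
theorem gaussConst_le_sqrt {s : ℕ} (hs : 1 ≤ s) : gaussConst s ≤ Real.sqrt s := by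
  have hs' : (0 : ℝ) < (s : ℝ) / 2 := by positivity
  have hG := Real.Gamma_pos_of_pos hs'
  have h := Real.Gamma_mul_add_mul_le_rpow_Gamma_mul_rpow_Gamma hs'
    (show (0 : ℝ) < (s : ℝ) / 2 + 1 by positivity) one_half_pos one_half_pos (by norm_num)
  rw [Real.Gamma_add_one hs'.ne', ← Real.sqrt_eq_rpow, ← Real.sqrt_eq_rpow,
    ← Real.sqrt_mul hG.le, show Real.Gamma ((s : ℝ) / 2) * ((s : ℝ) / 2 * Real.Gamma ((s : ℝ) / 2))
      = (s : ℝ) / 2 * Real.Gamma ((s : ℝ) / 2) ^ 2 by ring, Real.sqrt_mul hs'.le,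
    Real.sqrt_sq hG.le, show 1 / 2 * ((s : ℝ) / 2) + 1 / 2 * ((s : ℝ) / 2 + 1) = ((s : ℝ) + 1) / 2
      by ring] at h
  rw [gaussConst, div_le_iff₀ hG]
  calc _ ≤ Real.sqrt 2 * (Real.sqrt ((s : ℝ) / 2) * Real.Gamma ((s : ℝ) / 2)) := by gcongr
    _ = _ := by rw [← mul_assoc, ← Real.sqrt_mul two_pos.le]; congr 2; ring

/-! ### Support functions and Gaussian combinations of rows. -/

noncomputable section

/-- The support function of a set. -/
def supportFun {E : Type*} [NormedAddCommGroup E] [InnerProductSpace ℝ E] (S : Set E) (z : E) : ℝ :=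
  ⨆ y : S, inner ℝ z (y : E)

section

variable {E : Type*} [NormedAddCommGroup E] [InnerProductSpace ℝ E] {S : Set E} {a : ℝ}

theorem inner_le_of_subset_closedBall (hSa : S ⊆ Metric.closedBall 0 a) (z : E) (y : S) :
    inner ℝ z (y : E) ≤ a * ‖z‖ := by
  have hy : ‖(y : E)‖ ≤ a := by simpa using hSa y.2
  calc inner ℝ z (y : E) ≤ ‖z‖ * ‖(y : E)‖ := real_inner_le_norm _ _
    _ ≤ ‖z‖ * a := by gcongr
    _ = _ := mul_comm _ _

theorem bddAbove_inner_of_subset_closedBall (hSa : S ⊆ Metric.closedBall 0 a) (z : E) :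
    BddAbove (Set.range fun y : S => inner ℝ z (y : E)) :=
  ⟨a * ‖z‖, by rintro _ ⟨y, rfl⟩; exact inner_le_of_subset_closedBall hSa z y⟩

theorem supportFun_le_add (hS : S.Nonempty) (hSa : S ⊆ Metric.closedBall 0 a) (z w : E) :
    supportFun S z ≤ supportFun S w + a * ‖z - w‖ := by
  have := hS.to_subtype
  refine ciSup_le fun y => ?_
  have h1 : inner ℝ w (y : E) ≤ supportFun S w :=
    le_ciSup (bddAbove_inner_of_subset_closedBall hSa w) y
  have h2 := inner_le_of_subset_closedBall hSa (z - w) y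
  rw [inner_sub_left] at h2
  linarith

theorem abs_supportFun_sub_le (hS : S.Nonempty) (hSa : S ⊆ Metric.closedBall 0 a) (z w : E) :
    |supportFun S z - supportFun S w| ≤ a * ‖z - w‖ := by
  rw [abs_sub_le_iff]
  have h1 := supportFun_le_add hS hSa z w
  have h2 := supportFun_le_add hS hSa w z
  rw [norm_sub_rev] at h2
  constructor <;> linarith

theorem abs_supportFun_le (hS : S.Nonempty) (hSa : S ⊆ Metric.closedBall 0 a) (z : E) :
    |supportFun S z| ≤ a * ‖z‖ := by
  have := hS.to_subtype
  have h0 : supportFun S 0 = 0 := by simp [supportFun]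
  simpa [h0] using abs_supportFun_sub_le hS hSa z 0

theorem continuous_supportFun (hS : S.Nonempty) (hSa : S ⊆ Metric.closedBall 0 a) :
    Continuous (supportFun S) :=
  (LipschitzWith.of_dist_le' (K := a) fun z w => by
    rw [Real.dist_eq, dist_eq_norm]; exact abs_supportFun_sub_le hS hSa z w).continuous

theorem supportFun_smul {r : ℝ} (hr : 0 < r) (z : E) :
    supportFun S (r • z) = r * supportFun S z := by
  simp only [supportFun, real_inner_smul_left]
  exact (Real.mul_iSup_of_nonneg hr.le _).symm

end

/-- The linear combination with coefficients `x i` of the rows of the matrix with entries `G`. -/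
def rowComb {d s : ℕ} (x : EuclideanSpace ℝ (Fin d)) (G : EuclideanSpace ℝ (Fin d × Fin s)) :
    EuclideanSpace ℝ (Fin s) :=
  WithLp.toLp 2 fun j => ∑ i, x i * G (i, j)

section

variable {d s : ℕ}

@[simp]
theorem rowComb_apply (x : EuclideanSpace ℝ (Fin d)) (G : EuclideanSpace ℝ (Fin d × Fin s))
    (j : Fin s) : rowComb x G j = ∑ i, x i * G (i, j) := rfl

theorem rowComb_sub (x : EuclideanSpace ℝ (Fin d)) (G H : EuclideanSpace ℝ (Fin d × Fin s)) :
    rowComb x (G - H) = rowComb x G - rowComb x H := by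
  ext j; simp [mul_sub]

theorem smul_rowComb (r : ℝ) (x : EuclideanSpace ℝ (Fin d))
    (G : EuclideanSpace ℝ (Fin d × Fin s)) : rowComb (r • x) G = r • rowComb x G := by
  ext j; simp [Finset.mul_sum, mul_assoc]

theorem rowComb_smul (r : ℝ) (x : EuclideanSpace ℝ (Fin d))
    (G : EuclideanSpace ℝ (Fin d × Fin s)) : rowComb x (r • G) = r • rowComb x G := by
  ext j; simp [Finset.mul_sum, mul_left_comm]

theorem Continuous.rowComb {X : Type*} [TopologicalSpace X] {f : X → EuclideanSpace ℝ (Fin d)}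
    {g : X → EuclideanSpace ℝ (Fin d × Fin s)} (hf : Continuous f) (hg : Continuous g) :
    Continuous fun z => rowComb (f z) (g z) := by
  unfold _root_.rowComb; fun_prop

theorem norm_rowComb_le (x : EuclideanSpace ℝ (Fin d)) (G : EuclideanSpace ℝ (Fin d × Fin s)) :
    ‖rowComb x G‖ ≤ ‖x‖ * ‖G‖ := by
  rw [← sq_le_sq₀ (norm_nonneg _) (by positivity), mul_pow]
  simp only [EuclideanSpace.norm_sq_eq, Real.norm_eq_abs, sq_abs, rowComb_apply]
  rw [Fintype.sum_prod_type_right, Finset.mul_sum]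
  exact Finset.sum_le_sum fun j _ => Finset.sum_mul_sq_le_sq_mul_sq _ _ _

theorem map_rowComb_stdGaussian {x : EuclideanSpace ℝ (Fin d)} (hx : ‖x‖ = 1) :
    (stdGaussian (EuclideanSpace ℝ (Fin d × Fin s))).map (rowComb x)
      = stdGaussian (EuclideanSpace ℝ (Fin s)) := by
  have hm : Continuous (rowComb (s := s) x) :=
    continuous_const.rowComb continuous_id
  have : IsProbabilityMeasure
      ((stdGaussian (EuclideanSpace ℝ (Fin d × Fin s))).map (rowComb x)) :=
    Measure.isProbabilityMeasure_map hm.measurable.aemeasurable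
  refine Measure.ext_of_charFun (funext fun t => ?_)
  -- With `w = x ⊗ t`, pairing `rowComb x G` with `t` is pairing `G` with `w`, and `‖w‖ = ‖t‖`
  -- because `x` is a unit vector.
  set w : EuclideanSpace ℝ (Fin d × Fin s) := WithLp.toLp 2 fun p => x p.1 * t p.2 with hw
  have h1 : ∀ G, inner ℝ (rowComb x G) t = inner ℝ G w := fun G => by
    simp only [PiLp.inner_apply, rowComb_apply, hw, RCLike.inner_apply, conj_trivial]
    rw [Fintype.sum_prod_type_right]
    refine Finset.sum_congr rfl fun j _ => ?_
    rw [Finset.mul_sum]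
    exact Finset.sum_congr rfl fun i _ => by ring
  have h2 : ‖w‖ ^ 2 = ‖t‖ ^ 2 := by
    have hx2 : ∑ i, x i ^ 2 = 1 := by
      have := EuclideanSpace.norm_sq_eq x
      simpa [hx] using this.symm
    simp only [EuclideanSpace.norm_sq_eq, Real.norm_eq_abs, sq_abs, hw]
    rw [Fintype.sum_prod_type_right]
    refine Finset.sum_congr rfl fun j _ => ?_
    simp only [mul_pow]
    rw [← Finset.sum_mul, hx2, one_mul]
  rw [charFun_apply, integral_map hm.measurable.aemeasurable (by fun_prop)]
  simp_rw [h1]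
  rw [← charFun_apply, charFun_stdGaussian, charFun_stdGaussian]
  norm_cast
  rw [h2]

/-- Each coordinate of `rowComb x G` is a linear form in `x`, whose variance is the squared norm of
a column of `G`. -/
theorem integral_norm_rowComb_sq (G : EuclideanSpace ℝ (Fin d × Fin s)) :
    ∫ x, ‖rowComb x G‖ ^ 2 ∂stdGaussian (EuclideanSpace ℝ (Fin d)) = ‖G‖ ^ 2 := by
  set c : Fin s → EuclideanSpace ℝ (Fin d) := fun j => WithLp.toLp 2 fun i => G (i, j) with hc
  have h1 : ∀ x, ‖rowComb x G‖ ^ 2 = ∑ j, (innerSL ℝ (c j) x) ^ 2 := fun x => by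
    simp [EuclideanSpace.norm_sq_eq, hc, PiLp.inner_apply]
  simp_rw [h1]
  rw [integral_finsetSum _ fun j _ => ((IsGaussian.memLp_dual _ (innerSL ℝ (c j)) 2
    (by simp)).integrable_sq)]
  simp_rw [integral_sq_strongDual_stdGaussian, innerSL_apply_norm]
  simp only [EuclideanSpace.norm_sq_eq, hc]
  rw [Fintype.sum_prod_type_right]

end

/-- The normalized surface measure on the Euclidean unit sphere. -/
abbrev sphereProb (d : ℕ) : Measure (Metric.sphere (0 : EuclideanSpace ℝ (Fin d)) 1) :=
  ((volume : Measure (EuclideanSpace ℝ (Fin d))).toSphere Set.univ)⁻¹ •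
    (volume : Measure (EuclideanSpace ℝ (Fin d))).toSphere

theorem isProbabilityMeasure_sphereProb {d : ℕ} (hd : 1 ≤ d) :
    IsProbabilityMeasure (sphereProb d) := by
  have : NeZero d := ⟨by omega⟩
  have : NeZero ((volume : Measure (EuclideanSpace ℝ (Fin d))).toSphere) :=
    ⟨Measure.toSphere_ne_zero _⟩
  infer_instance

/-! ### Mean and Lipschitz constant of `M^*` of the image. -/

section

variable {d s : ℕ}

theorem Mstar_eq_integral (S : Set (EuclideanSpace ℝ (Fin s))) :
    Mstar S = ∫ x, supportFun S (x : EuclideanSpace ℝ (Fin s)) ∂sphereProb s := rfl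

theorem supportFun_matImage (G : EuclideanSpace ℝ (Fin d × Fin s))
    (S : Set (EuclideanSpace ℝ (Fin s))) (x : EuclideanSpace ℝ (Fin d)) :
    supportFun (matImage (fun i j => G (i, j)) S) x = supportFun S (rowComb x G) := by
  unfold supportFun matImage
  rw [← Set.imageFactorization_surjective.iSup_comp]
  refine iSup_congr fun y => ?_
  simp only [Set.imageFactorization, PiLp.inner_apply, RCLike.inner_apply, conj_trivial,
    Matrix.mulVec, dotProduct, rowComb_apply, Finset.mul_sum, Finset.sum_mul]
  rw [Finset.sum_comm]
  exact Finset.sum_congr rfl fun i _ => Finset.sum_congr rfl fun j _ => by ring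

/-- The functional `M^*` of the image of `S` under the matrix with entries `G`. -/
def MstarImage (S : Set (EuclideanSpace ℝ (Fin s))) (G : EuclideanSpace ℝ (Fin d × Fin s)) : ℝ :=
  ∫ x, supportFun S (rowComb (x : EuclideanSpace ℝ (Fin d)) G) ∂sphereProb d

theorem Mstar_matImage (S : Set (EuclideanSpace ℝ (Fin s)))
    (G : EuclideanSpace ℝ (Fin d × Fin s)) :
    Mstar (matImage (fun i j => G (i, j)) S) = MstarImage S G := by
  simp only [Mstar_eq_integral, supportFun_matImage, MstarImage]

theorem MstarImage_smul (S : Set (EuclideanSpace ℝ (Fin s))) {r : ℝ} (hr : 0 < r)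
    (G : EuclideanSpace ℝ (Fin d × Fin s)) : MstarImage S (r • G) = r * MstarImage S G := by
  simp only [MstarImage, rowComb_smul, supportFun_smul hr, integral_const_mul]

variable {S : Set (EuclideanSpace ℝ (Fin s))} {a : ℝ}

theorem integral_supportFun_stdGaussian (hs : 1 ≤ s) :
    ∫ z, supportFun S z ∂stdGaussian (EuclideanSpace ℝ (Fin s)) = gaussConst s * Mstar S := by
  have : NeZero s := ⟨by omega⟩
  rw [integral_stdGaussian_of_homogeneous (k := 1) fun r x hr => by
    rw [pow_one, supportFun_smul hr]]
  simp only [pow_one, integral_norm_stdGaussian_euclideanSpace hs]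
  rfl

theorem integrable_of_continuous_sphere (hd : 1 ≤ d)
    {f : Metric.sphere (0 : EuclideanSpace ℝ (Fin d)) 1 → ℝ} (hf : Continuous f) :
    Integrable f (sphereProb d) := by
  have := isProbabilityMeasure_sphereProb hd
  exact hf.integrable_of_hasCompactSupport (HasCompactSupport.of_compactSpace f)

theorem integral_MstarImage (hd : 1 ≤ d) (hs : 1 ≤ s) (hS : S.Nonempty)
    (hSa : S ⊆ Metric.closedBall 0 a) (ha : 0 ≤ a) :
    ∫ G, MstarImage S G ∂stdGaussian (EuclideanSpace ℝ (Fin d × Fin s))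
      = gaussConst s * Mstar S := by
  have := isProbabilityMeasure_sphereProb hd
  unfold MstarImage
  rw [integral_integral_swap]
  · have h1 : ∀ x : Metric.sphere (0 : EuclideanSpace ℝ (Fin d)) 1,
        ∫ G, supportFun S (rowComb (x : EuclideanSpace ℝ (Fin d)) G)
          ∂stdGaussian (EuclideanSpace ℝ (Fin d × Fin s)) = gaussConst s * Mstar S := fun x => by
      have hm : Continuous (rowComb (s := s) (x : EuclideanSpace ℝ (Fin d))) :=
        continuous_const.rowComb continuous_id
      rw [← integral_map (φ := rowComb (x : EuclideanSpace ℝ (Fin d)))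
        hm.measurable.aemeasurable (continuous_supportFun hS hSa).aestronglyMeasurable,
        map_rowComb_stdGaussian (by simp), integral_supportFun_stdGaussian hs]
    simp [h1]
  -- Fubini is justified by the bound `a * ‖G‖`, uniform over the sphere.
  · have h2 : Integrable (fun p : EuclideanSpace ℝ (Fin d × Fin s) ×
        Metric.sphere (0 : EuclideanSpace ℝ (Fin d)) 1 => a * ‖p.1‖)
        ((stdGaussian (EuclideanSpace ℝ (Fin d × Fin s))).prod (sphereProb d)) :=
      (IsGaussian.integrable_id.norm.const_mul a).comp_fst _
    refine h2.mono' ?_ (.of_forall fun p => ?_)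
    · have h3 : Continuous fun p : EuclideanSpace ℝ (Fin d × Fin s) ×
          Metric.sphere (0 : EuclideanSpace ℝ (Fin d)) 1 =>
          supportFun S (rowComb (p.2 : EuclideanSpace ℝ (Fin d)) p.1) :=
        (continuous_supportFun hS hSa).comp
          ((continuous_subtype_val.comp continuous_snd).rowComb continuous_fst)
      exact h3.aestronglyMeasurable
    · refine (abs_supportFun_le hS hSa _).trans ?_
      gcongr
      simpa using norm_rowComb_le (p.2 : EuclideanSpace ℝ (Fin d)) p.1

/-- By homogeneity of degree 2, the Gaussian mean `‖G‖ ^ 2` is `E‖x‖² = d` times the spherical mean.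
-/
theorem integral_norm_rowComb_sq_sphereProb (hd : 1 ≤ d) (G : EuclideanSpace ℝ (Fin d × Fin s)) :
    ∫ x, ‖rowComb (x : EuclideanSpace ℝ (Fin d)) G‖ ^ 2 ∂sphereProb d = ‖G‖ ^ 2 / d := by
  have : NeZero d := ⟨by omega⟩
  have hd0 : (d : ℝ) ≠ 0 := by exact_mod_cast NeZero.ne d
  rw [eq_div_iff hd0, mul_comm, ← integral_norm_rowComb_sq G,
    integral_stdGaussian_of_homogeneous (φ := fun x => ‖rowComb x G‖ ^ 2) (k := 2) fun r x hr => by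
      rw [smul_rowComb, norm_smul, mul_pow, Real.norm_of_nonneg hr.le],
    integral_norm_sq_stdGaussian_euclideanSpace hd]
  rfl

theorem lipschitzWith_MstarImage (hd : 1 ≤ d) (hS : S.Nonempty)
    (hSa : S ⊆ Metric.closedBall 0 a) (ha : 0 ≤ a) :
    LipschitzWith (Real.toNNReal (a / Real.sqrt d)) (MstarImage (d := d) S) := by
  have := isProbabilityMeasure_sphereProb hd
  refine LipschitzWith.of_dist_le_mul fun G H => ?_
  have hcont : ∀ G : EuclideanSpace ℝ (Fin d × Fin s),
      Continuous fun x : Metric.sphere (0 : EuclideanSpace ℝ (Fin d)) 1 =>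
        rowComb (x : EuclideanSpace ℝ (Fin d)) G := fun G =>
    continuous_subtype_val.rowComb continuous_const
  have hi : ∀ G : EuclideanSpace ℝ (Fin d × Fin s), Integrable
      (fun x : Metric.sphere (0 : EuclideanSpace ℝ (Fin d)) 1 =>
        supportFun S (rowComb (x : EuclideanSpace ℝ (Fin d)) G)) (sphereProb d) := fun G =>
    integrable_of_continuous_sphere hd ((continuous_supportFun hS hSa).comp (hcont G))
  have hn : Integrable (fun x : Metric.sphere (0 : EuclideanSpace ℝ (Fin d)) 1 =>
      ‖rowComb (x : EuclideanSpace ℝ (Fin d)) (G - H)‖) (sphereProb d) :=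
    integrable_of_continuous_sphere hd (hcont _).norm
  have hn2 : Integrable (fun x : Metric.sphere (0 : EuclideanSpace ℝ (Fin d)) 1 =>
      ‖rowComb (x : EuclideanSpace ℝ (Fin d)) (G - H)‖ ^ 2) (sphereProb d) :=
    integrable_of_continuous_sphere hd ((hcont _).norm.pow 2)
  -- Jensen for the square; this is the source of the gain `1 / √d`.
  have hJ : ∫ x, ‖rowComb (x : EuclideanSpace ℝ (Fin d)) (G - H)‖ ∂sphereProb d
      ≤ ‖G - H‖ / Real.sqrt d := by
    refine le_of_sq_le_sq ?_ (by positivity)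
    rw [div_pow, Real.sq_sqrt (Nat.cast_nonneg d), ← integral_norm_rowComb_sq_sphereProb hd]
    exact (even_two.convexOn_pow (𝕜 := ℝ)).map_integral_le (continuous_pow 2).continuousOn
      isClosed_univ (by simp) hn hn2
  rw [Real.coe_toNNReal _ (by positivity), Real.dist_eq, dist_eq_norm]
  calc |MstarImage S G - MstarImage S H|
      = |∫ x, (supportFun S (rowComb (x : EuclideanSpace ℝ (Fin d)) G)
          - supportFun S (rowComb (x : EuclideanSpace ℝ (Fin d)) H)) ∂sphereProb d| := by
        rw [MstarImage, MstarImage, integral_sub (hi G) (hi H)]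
    _ ≤ ∫ x, |supportFun S (rowComb (x : EuclideanSpace ℝ (Fin d)) G)
          - supportFun S (rowComb (x : EuclideanSpace ℝ (Fin d)) H)| ∂sphereProb d :=
        abs_integral_le_integral_abs
    _ ≤ ∫ x, a * ‖rowComb (x : EuclideanSpace ℝ (Fin d)) (G - H)‖ ∂sphereProb d :=
        integral_mono ((hi G).sub (hi H)).abs (hn.const_mul a) fun x => by
          rw [rowComb_sub]; exact abs_supportFun_sub_le hS hSa _ _
    _ ≤ a * (‖G - H‖ / Real.sqrt d) := by rw [integral_const_mul]; gcongr
    _ = _ := by ring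

end

/-! ### Reduction to the standard Gaussian matrix and conclusion. -/

section

variable {Ω : Type*} [MeasurableSpace Ω] {P : Measure Ω} {d s : ℕ} {σ : ℝ}
  {A : Ω → Matrix (Fin d) (Fin s) ℝ}

theorem IsGaussianMatrix.aemeasurable_entries (hA : IsGaussianMatrix P A σ) :
    AEMeasurable (fun ω => WithLp.toLp 2 fun p : Fin d × Fin s => σ⁻¹ * A ω p.1 p.2) P :=
  (WithLp.measurable_toLp 2 _).comp_aemeasurable
    (aemeasurable_pi_lambda _ fun p => (hA.law p.1 p.2).aemeasurable.const_mul _)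

theorem IsGaussianMatrix.map_entries [IsProbabilityMeasure P] (hA : IsGaussianMatrix P A σ)
    (hσ : 0 < σ) :
    P.map (fun ω => WithLp.toLp 2 fun p : Fin d × Fin s => σ⁻¹ * A ω p.1 p.2)
      = stdGaussian (EuclideanSpace ℝ (Fin d × Fin s)) := by
  have hm : ∀ p : Fin d × Fin s, AEMeasurable (fun ω => σ⁻¹ * A ω p.1 p.2) P := fun p =>
    (hA.law p.1 p.2).aemeasurable.const_mul _
  have hind : iIndepFun (fun (p : Fin d × Fin s) ω => σ⁻¹ * A ω p.1 p.2) P :=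
    hA.indep.comp (fun _ x => σ⁻¹ * x) fun _ => by fun_prop
  have hlaw : ∀ p : Fin d × Fin s, P.map (fun ω => σ⁻¹ * A ω p.1 p.2) = gaussianReal 0 1 :=
    fun p => by
      have h := gaussianReal_map_const_mul (μ := 0) (v := Real.toNNReal (σ ^ 2)) σ⁻¹
      rw [← (hA.law p.1 p.2).map_eq, AEMeasurable.map_map_of_aemeasurable (by fun_prop)
        (hA.law p.1 p.2).aemeasurable] at h
      refine h.trans ?_
      rw [mul_zero]
      congr 1
      ext
      simp only [NNReal.coe_mul, NNReal.coe_mk, Real.coe_toNNReal _ (sq_nonneg σ), NNReal.coe_one]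
      field_simp
  rw [← map_pi_eq_stdGaussian]
  have h := hind.map_fun_eq_pi_map hm
  simp only [hlaw] at h
  rw [← h, AEMeasurable.map_map_of_aemeasurable (by fun_prop) (aemeasurable_pi_lambda _ hm)]
  rfl

end

end

theorem lemma3p3 {Ω : Type*} [MeasurableSpace Ω] (P : Measure Ω) [IsProbabilityMeasure P]
    (d s : ℕ) (hd : 1 ≤ d) (hds : d ≤ s) (σ : ℝ) (hσ : 0 < σ)
    (A : Ω → Matrix (Fin d) (Fin s) ℝ) (hA : IsGaussianMatrix P A σ)
    (a : ℝ) (ha : 0 < a) (S : ConvexBody (EuclideanSpace ℝ (Fin s)))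
    (hsymm : ∀ x ∈ S, -x ∈ S)
    (hSa : (S : Set (EuclideanSpace ℝ (Fin s))) ⊆ Metric.closedBall 0 a) :
    Integrable (fun ω => Mstar (matImage (A ω) S)) P ∧
    ∫ ω, Mstar (matImage (A ω) S) ∂P
      = gaussConst s * σ * Mstar (S : Set (EuclideanSpace ℝ (Fin s))) ∧
    gaussConst s ≤ Real.sqrt s ∧
    ∀ t : ℝ, 0 < t →
      P.real {ω | gaussConst s * σ * Mstar (S : Set (EuclideanSpace ℝ (Fin s))) + t
          < Mstar (matImage (A ω) S)}
        ≤ Real.exp (-((d : ℝ) * t ^ 2) / (2 * a ^ 2 * σ ^ 2)) := by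
  have hs : 1 ≤ s := hd.trans hds
  set K := (S : Set (EuclideanSpace ℝ (Fin s)))
  have hS : K.Nonempty := S.nonempty
  set G : Ω → EuclideanSpace ℝ (Fin d × Fin s) :=
    fun ω => WithLp.toLp 2 fun p : Fin d × Fin s => σ⁻¹ * A ω p.1 p.2 with hG
  have hGm : AEMeasurable G P := hA.aemeasurable_entries
  have hGlaw : P.map G = stdGaussian _ := hA.map_entries hσ
  have hval : ∀ ω, Mstar (matImage (A ω) K) = σ * MstarImage K (G ω) := fun ω => by
    rw [← MstarImage_smul K hσ, ← Mstar_matImage]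
    congr 2
    ext i j
    simp [hG, hσ.ne']
  have hlip := lipschitzWith_MstarImage hd hS hSa ha.le
  have hF : Continuous (MstarImage (d := d) K) := hlip.continuous
  have hint : Integrable (fun ω => MstarImage K (G ω)) P := by
    have := integrable_stdGaussian_of_lipschitzWith hlip
    rw [← hGlaw] at this
    exact this.comp_aemeasurable hGm
  have hmean := integral_MstarImage hd hs hS hSa ha.le
  simp only [hval]
  refine ⟨hint.const_mul σ, ?_, gaussConst_le_sqrt hs, fun t ht => ?_⟩
  · rw [integral_const_mul, ← integral_map hGm hF.aestronglyMeasurable, hGlaw, hmean]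
    ring
  · have hd0 : (0 : ℝ) < d := by exact_mod_cast hd
    have hL : 0 < a / Real.sqrt d := by positivity
    -- After normalizing the entries by `σ`, the deviation is `t / σ` and the Lipschitz constant is
    -- `a / √d`.
    have hconc := stdGaussian_measure_ge_le_exp (Real.toNNReal_pos.2 hL) hlip (div_pos ht hσ)
    rw [hmean, ← hGlaw, Measure.map_apply_of_aemeasurable hGm
      (measurableSet_le measurable_const hF.measurable), Real.coe_toNNReal _ hL.le] at hconc
    refine ENNReal.toReal_le_of_le_ofReal (Real.exp_pos _).le ?_
    refine (measure_mono fun ω hω => ?_).trans (hconc.trans_eq ?_)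
    · have hω' : gaussConst s * σ * Mstar K + t < σ * MstarImage K (G ω) := hω
      change gaussConst s * Mstar K + t / σ ≤ MstarImage K (G ω)
      rw [← mul_le_mul_iff_right₀ hσ, mul_add, mul_div_cancel₀ _ hσ.ne']
      linarith
    · congr 2
      rw [div_pow, div_pow, Real.sq_sqrt hd0.le]
      field_simp
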